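/- Consider bilateral trade of one item between a seller with value $S\sim F_S$ and a buyer with value $B\sim F_B$, where $S,B\ge 0$ are independent and have finite means. A (possibly randomized) fixed-price mechanism $\mathcal M$ maps an instance $\mathcal I=(F_S,F_B)$ to a probability distribution $\mathcal M(\mathcal I)$ on $[0,\infty)$, from which a price $p$ is drawn independently of $S,B$; trade happens iff $S\le p\le B$. Its welfare is $\mathcal W(\mathcal M,\mathcal I)=\mathbb E\big[S+\mathbf 1[S\le p\le B]\,(B-S)\big]$, the optimal welfare is $\mathrm{OPT}(\mathcal I)=\mathbb E[\max(S,B)]$, and the approximation ratio of $\mathcal M$ is $\inf_{\mathcal I}\mathcal W(\mathcal M,\mathcal I)/\mathrm{OPT}(\mathcal I)$ over all instances with $\mathrm{OPT}(\mathcal I)>0$. A mechanism uses only the buyer's (respectively the seller's) distribution if $\mathcal M(F_S,F_B)$ depends only on $F_B$ (respectively only on $F_S$). Theorem. Among all fixed-price mechanisms there is one with the largest approximation ratio; call this ratio $r^*$. Among the fixed-price mechanisms that use only the buyer's distribution there is also one with the largest approximation ratio, and this ratio is exactly $r^*$; the same holds for the fixed-price mechanisms that use only the seller's distribution. All of this holds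 when $F_S$ and $F_B$ range over the continuous distributions (those without point masses), and also when they range over all distributions, with $r^*$ taken with respect to the class in question. -/

import Mathlib

open MeasureTheory
open scoped NNReal

noncomputable section

namespace BilateralTrade

/-- A value distribution: a probability measure on `[0, ∞)` with finite mean. -/
structure ValueDist where
  law : Measure ℝ≥0
  isProb : IsProbabilityMeasure law
  finiteMean : Integrable (fun x : ℝ≥0 => (x : ℝ)) law

/-- The class of all value distributions. -/
def allDists : Set ValueDist := Set.univ

/-- The class of continuous value distributions, i.e. those without point masses. -/
def continuousDists : Set ValueDist := {F | ∀ x : ℝ≥0, F.law {x} = 0}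

/-- The optimal welfare `E[max(S, B)]`, for independent `S ∼ F_S` and `B ∼ F_B`. -/
def optWelfare (FS FB : ValueDist) : ℝ :=
  ∫ x : ℝ≥0 × ℝ≥0, max (x.1 : ℝ) (x.2 : ℝ) ∂(FS.law.prod FB.law)

/-- The expected welfare `E[S + 1[S ≤ p ≤ B] (B - S)]` of the fixed price `p`,
for independent `S ∼ F_S` and `B ∼ F_B`. -/
def priceWelfare (p : ℝ≥0) (FS FB : ValueDist) : ℝ :=
  ∫ x : ℝ≥0 × ℝ≥0,
    ((x.1 : ℝ) + if x.1 ≤ p ∧ p ≤ x.2 then (x.2 : ℝ) - (x.1 : ℝ) else 0)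
    ∂(FS.law.prod FB.law)

/-- A (possibly randomized) fixed-price mechanism with full prior information: it maps an
instance `(F_S, F_B)` to the distribution of the price that it posts. -/
abbrev Mechanism : Type := ValueDist → ValueDist → ProbabilityMeasure ℝ≥0

/-- The mechanism has access to the buyer's distribution only. -/
def Mechanism.BuyerOnly (M : Mechanism) : Prop :=
  ∃ m : ValueDist → ProbabilityMeasure ℝ≥0, ∀ FS FB : ValueDist, M FS FB = m FB

/-- The mechanism has access to the seller's distribution only. -/
def Mechanism.SellerOnly (M : Mechanism) : Prop :=
  ∃ m : ValueDist → ProbabilityMeasure ℝ≥0, ∀ FS FB : ValueDist, M FS FB = m FS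

/-- The expected welfare of the mechanism `M` on the instance `(F_S, F_B)`, where the price
is drawn from `M(F_S, F_B)` independently of the values. -/
def welfare (M : Mechanism) (FS FB : ValueDist) : ℝ :=
  ∫ p : ℝ≥0, priceWelfare p FS FB ∂(M FS FB : Measure ℝ≥0)

/-- The (worst-case) approximation ratio of `M` over the instances with both distributions
in `D`: the infimum of welfare over optimal welfare. Only the degenerate instance, whose
optimal welfare is `0`, is left out. -/
def approxRatio (D : Set ValueDist) (M : Mechanism) : ℝ :=
  sInf {ρ : ℝ | ∃ FS ∈ D, ∃ FB ∈ D, 0 < optWelfare FS FB ∧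
    ρ = welfare M FS FB / optWelfare FS FB}

/-- `r` is the approximation ratio of an optimal mechanism among those that satisfy `P`:
some such mechanism attains `r` and none has a larger ratio. -/
def IsOptimalRatio (D : Set ValueDist) (P : Mechanism → Prop) (r : ℝ) : Prop :=
  IsGreatest {ρ : ℝ | ∃ M : Mechanism, P M ∧ ρ = approxRatio D M} r

end BilateralTrade

end

noncomputable section

namespace BilateralTrade

open Filter Topology
open scoped unitInterval

/-- A minimax theorem: if every function of a convex family of continuous functions on a compact
space is somewhere nonnegative, then some probability measure gives all of them a nonnegative
integral. -/
theorem exists_probabilityMeasure_integral_nonneg {X : Type*} [TopologicalSpace X] [CompactSpace X]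
    [T2Space X] [MeasurableSpace X] [BorelSpace X] {A : Set C(X, ℝ)} (hA : Convex ℝ A)
    (hne : A.Nonempty) (hpos : ∀ f ∈ A, ∃ x, 0 ≤ f x) :
    ∃ m : ProbabilityMeasure X, ∀ f ∈ A, 0 ≤ ∫ x, f x ∂(m : Measure X) := by
  set N : Set C(X, ℝ) := {f | ∀ x, f x < 0} with hN
  have hNconv : Convex ℝ N := by
    intro f hf g hg a b ha hb hab x
    simp only [ContinuousMap.add_apply, ContinuousMap.smul_apply, smul_eq_mul]
    have h1 := hf x
    have h2 := hg x
    rcases ha.eq_or_lt with rfl | ha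
    · have : b = 1 := by linarith
      subst this
      linarith
    · nlinarith [mul_pos ha (neg_pos.2 h1), mul_nonneg hb (neg_pos.2 h2).le]
  have hNopen : IsOpen N := by
    have : N = {f : C(X, ℝ) | Set.MapsTo f Set.univ (Set.Iio 0)} := by
      ext f
      simp [hN, Set.MapsTo]
    rw [this]
    exact ContinuousMap.isOpen_setOfPred_mapsTo isCompact_univ isOpen_Iio
  have hdisj : Disjoint N A := by
    rw [Set.disjoint_left]
    intro f hf hfA
    obtain ⟨x, hx⟩ := hpos f hfA
    exact absurd (hf x) (not_lt.2 hx)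
  obtain ⟨Λ, u, hΛN, hΛA⟩ := geometric_hahn_banach_open hNconv hNopen hA hdisj
  have hscale : ∀ f ∈ N, ∀ c : ℝ, 0 < c → c * Λ f < u := by
    intro f hf c hc
    have : c • f ∈ N := fun x => by
      simpa using mul_neg_of_pos_of_neg hc (hf x)
    simpa using hΛN _ this
  have hneg1 : (-1 : C(X, ℝ)) ∈ N := fun x => by simp
  have hu : 0 ≤ u := by
    have hlim : Tendsto (fun c : ℝ => c * Λ (-1)) (𝓝[>] 0) (𝓝 (0 * Λ (-1))) :=
      ((continuous_id.mul continuous_const).tendsto 0).mono_left nhdsWithin_le_nhds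
    rw [zero_mul] at hlim
    refine le_of_tendsto hlim ?_
    filter_upwards [self_mem_nhdsWithin] with c hc
    exact (hscale _ hneg1 c hc).le
  have hΛneg : ∀ f ∈ N, Λ f ≤ 0 := by
    intro f hf
    by_contra! h
    have := hscale f hf ((u + 1) / Λ f) (by positivity)
    rw [div_mul_cancel₀ _ h.ne'] at this
    linarith
  have hΛpos : ∀ f : C(X, ℝ), 0 ≤ f → 0 ≤ Λ f := by
    intro f hf
    have key : ∀ ε : ℝ, 0 < ε → 0 ≤ Λ f + ε * Λ 1 := by
      intro ε hε
      have hm : -(f + ε • (1 : C(X, ℝ))) ∈ N := fun x => by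
        have hx : 0 ≤ f x := hf x
        simp only [ContinuousMap.neg_apply, ContinuousMap.add_apply, ContinuousMap.smul_apply,
          ContinuousMap.one_apply, smul_eq_mul]
        linarith
      have := hΛneg _ hm
      simp only [map_neg, map_add, map_smul, smul_eq_mul] at this
      linarith
    have hlim : Tendsto (fun c : ℝ => Λ f + c * Λ 1) (𝓝[>] 0) (𝓝 (Λ f + 0 * Λ 1)) :=
      ((continuous_const.add (continuous_id.mul continuous_const)).tendsto 0).mono_left
        nhdsWithin_le_nhds
    rw [zero_mul, add_zero] at hlim
    refine ge_of_tendsto hlim ?_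
    filter_upwards [self_mem_nhdsWithin] with c hc
    exact key c hc
  let Λc : CompactlySupportedContinuousMap X ℝ →ₚ[ℝ] ℝ := PositiveLinearMap.mk₀
    { toFun := fun f => Λ (f : C(X, ℝ))
      map_add' := fun f g => by
        rw [← map_add]
        rfl
      map_smul' := fun c f => by
        rw [RingHom.id_apply, ← map_smul]
        rfl }
    (fun f hf => hΛpos _ (fun x => hf x))
  set μ : Measure X := RealRMK.rieszMeasure Λc with hμ
  have hint : ∀ f : C(X, ℝ), ∫ x, f x ∂μ = Λ f := by
    intro f
    exact RealRMK.integral_rieszMeasure Λc (CompactlySupportedContinuousMap.continuousMapEquiv f)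
  have hμ0 : μ ≠ 0 := by
    intro h0
    have hΛ0 : ∀ f, Λ f = 0 := fun f => by rw [← hint, h0, integral_zero_measure]
    obtain ⟨f, hf⟩ := hne
    have h1 := hΛA f hf
    have h2 := hΛN _ hneg1
    rw [hΛ0] at h1 h2
    linarith
  have hfin : IsFiniteMeasure μ := ⟨isCompact_univ.measure_lt_top⟩
  have : NeZero μ := ⟨hμ0⟩
  refine ⟨⟨(μ Set.univ)⁻¹ • μ, inferInstance⟩, fun f hf => ?_⟩
  simp only [ProbabilityMeasure.coe_mk]
  rw [integral_smul_measure, hint, smul_eq_mul]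
  exact mul_nonneg ENNReal.toReal_nonneg (hu.trans (hΛA f hf))

/-- The increasing homeomorphism `x ↦ x / (1 + x)` of `[0, ∞)` onto `[0, 1)`. -/
def squeeze (x : ℝ≥0) : ℝ := (x : ℝ) / (1 + x)

/-- The inverse of `squeeze`, with the point at infinity `1` sent to the price `0`. -/
def unsqueeze (t : I) : ℝ≥0 := Real.toNNReal ((t : ℝ) / (1 - t))

theorem continuous_squeeze : Continuous squeeze := by
  unfold squeeze
  refine Continuous.div (by fun_prop) (by fun_prop) (fun x => ?_)
  positivity

theorem squeeze_nonneg (x : ℝ≥0) : 0 ≤ squeeze x := by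
  unfold squeeze
  positivity

theorem squeeze_lt_one (x : ℝ≥0) : squeeze x < 1 := by
  unfold squeeze
  rw [div_lt_one (by positivity)]
  linarith

theorem squeeze_mono {x y : ℝ≥0} (h : x ≤ y) : squeeze x ≤ squeeze y := by
  unfold squeeze
  have h' : (x : ℝ) ≤ y := h
  rw [div_le_div_iff₀ (by positivity) (by positivity)]
  nlinarith

theorem measurable_unsqueeze : Measurable unsqueeze := by
  unfold unsqueeze
  fun_prop

theorem le_unsqueeze {s : ℝ≥0} {t : I} (ht : (t : ℝ) < 1) (h : squeeze s ≤ t) :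
    s ≤ unsqueeze t := by
  unfold unsqueeze squeeze at *
  rw [Real.le_toNNReal_iff_coe_le (div_nonneg t.2.1 (by linarith)), le_div_iff₀ (by linarith)]
  rw [div_le_iff₀ (by positivity)] at h
  linarith

theorem unsqueeze_le {b : ℝ≥0} {t : I} (h : (t : ℝ) ≤ squeeze b) : unsqueeze t ≤ b := by
  have ht : (t : ℝ) < 1 := h.trans_lt (squeeze_lt_one b)
  unfold unsqueeze squeeze at *
  rw [Real.toNNReal_le_iff_le_coe, div_le_iff₀ (by linarith)]
  rw [le_div_iff₀ (by positivity)] at h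
  linarith

/-- The distance of `t` from the interval `[squeeze x.1, squeeze x.2]`. -/
def gap (t : ℝ) (x : ℝ≥0 × ℝ≥0) : ℝ := max 0 (max (squeeze x.1 - t) (t - squeeze x.2))

/-- A continuous relaxation of the indicator of `squeeze x.1 ≤ t ≤ squeeze x.2`. -/
def bump (k : ℕ) (t : ℝ) (x : ℝ≥0 × ℝ≥0) : ℝ := max 0 (1 - k * gap t x)

theorem continuous_bump (k : ℕ) : Continuous (fun z : ℝ × ℝ≥0 × ℝ≥0 => bump k z.1 z.2) := by
  unfold bump gap
  have := continuous_squeeze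
  fun_prop

theorem gap_nonneg (t : ℝ) (x : ℝ≥0 × ℝ≥0) : 0 ≤ gap t x := le_max_left _ _

theorem bump_nonneg (k : ℕ) (t : ℝ) (x : ℝ≥0 × ℝ≥0) : 0 ≤ bump k t x := le_max_left _ _

theorem bump_le_one (k : ℕ) (t : ℝ) (x : ℝ≥0 × ℝ≥0) : bump k t x ≤ 1 :=
  max_le zero_le_one (sub_le_self _ (mul_nonneg k.cast_nonneg (gap_nonneg t x)))

theorem bump_antitone {k l : ℕ} (h : k ≤ l) (t : ℝ) (x : ℝ≥0 × ℝ≥0) :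
    bump l t x ≤ bump k t x := by
  unfold bump
  have : (k : ℝ) ≤ l := by exact_mod_cast h
  gcongr
  exact gap_nonneg t x

theorem gap_eq_zero_iff {t : ℝ} {x : ℝ≥0 × ℝ≥0} :
    gap t x = 0 ↔ squeeze x.1 ≤ t ∧ t ≤ squeeze x.2 := by
  unfold gap
  simp

theorem bump_eq_one {k : ℕ} {t : ℝ} {x : ℝ≥0 × ℝ≥0} (h : gap t x = 0) : bump k t x = 1 := by
  simp [bump, h]

theorem tendsto_bump (t : ℝ) (x : ℝ≥0 × ℝ≥0) :
    Tendsto (fun k => bump k t x) atTop (𝓝 (if gap t x = 0 then 1 else 0)) := by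
  split_ifs with h
  · simp only [bump_eq_one h]
    exact tendsto_const_nhds
  · have hpos : 0 < gap t x := (gap_nonneg t x).lt_of_ne' h
    refine tendsto_const_nhds.congr' ?_
    obtain ⟨n, hn⟩ := exists_nat_gt (1 / gap t x)
    filter_upwards [eventually_ge_atTop n] with k hk
    have hk' : (n : ℝ) ≤ k := by exact_mod_cast hk
    rw [div_lt_iff₀ hpos] at hn
    unfold bump
    rw [max_eq_left]
    nlinarith

/-- The value of the item to its final owner when the relaxed trade indicator is `c`. -/
def tradeValue (c : ℝ) (x : ℝ≥0 × ℝ≥0) : ℝ :=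
  (x.1 : ℝ) + (max (x.1 : ℝ) x.2 - x.1) * c

/-- The welfare of the posted price `p` under the joint law `μ` of the two values. -/
def jointWelfare (μ : Measure (ℝ≥0 × ℝ≥0)) (p : ℝ≥0) : ℝ :=
  ∫ x, ((x.1 : ℝ) + if x.1 ≤ p ∧ p ≤ x.2 then (x.2 : ℝ) - (x.1 : ℝ) else 0) ∂μ

/-- The optimal welfare under the joint law `μ` of the two values. -/
def jointOpt (μ : Measure (ℝ≥0 × ℝ≥0)) : ℝ := ∫ x, max (x.1 : ℝ) x.2 ∂μ

/-- The welfare under the joint law `μ` with a relaxed trade indicator, as a function of the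
squeezed price. -/
def relaxedWelfare (μ : Measure (ℝ≥0 × ℝ≥0)) (k : ℕ) (t : ℝ) : ℝ :=
  ∫ x, tradeValue (bump k t x) x ∂μ

theorem abs_tradeValue_le {c : ℝ} (h0 : 0 ≤ c) (h1 : c ≤ 1) (x : ℝ≥0 × ℝ≥0) :
    |tradeValue c x| ≤ max (x.1 : ℝ) x.2 := by
  unfold tradeValue
  have hs : (0 : ℝ) ≤ x.1 := x.1.2
  have hm : (x.1 : ℝ) ≤ max (x.1 : ℝ) x.2 := le_max_left _ _
  rw [abs_le]
  constructor <;> nlinarith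

theorem tradeValue_mono {c d : ℝ} (h : c ≤ d) (x : ℝ≥0 × ℝ≥0) :
    tradeValue c x ≤ tradeValue d x := by
  unfold tradeValue
  have hm : (x.1 : ℝ) ≤ max (x.1 : ℝ) x.2 := le_max_left _ _
  gcongr

theorem tradeValue_indicator (p : ℝ≥0) (x : ℝ≥0 × ℝ≥0) :
    tradeValue (if x.1 ≤ p ∧ p ≤ x.2 then 1 else 0) x =
      (x.1 : ℝ) + if x.1 ≤ p ∧ p ≤ x.2 then (x.2 : ℝ) - (x.1 : ℝ) else 0 := by
  unfold tradeValue
  split_ifs with h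
  · have : (x.1 : ℝ) ≤ x.2 := h.1.trans h.2
    rw [max_eq_right this]
    ring
  · ring

theorem continuous_tradeValue_bump (k : ℕ) :
    Continuous (fun z : ℝ × ℝ≥0 × ℝ≥0 => tradeValue (bump k z.1 z.2) z.2) := by
  unfold tradeValue
  have := continuous_bump k
  fun_prop

theorem measurable_welfare_integrand : Measurable (fun z : ℝ≥0 × ℝ≥0 × ℝ≥0 =>
    (z.2.1 : ℝ) + if z.2.1 ≤ z.1 ∧ z.1 ≤ z.2.2 then (z.2.2 : ℝ) - (z.2.1 : ℝ) else 0) := by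
  refine Measurable.add (by fun_prop) (Measurable.ite ?_ (by fun_prop) measurable_const)
  exact (measurableSet_le (by fun_prop) (by fun_prop)).inter
    (measurableSet_le (by fun_prop) (by fun_prop))

section JointLaw

variable {μ : Measure (ℝ≥0 × ℝ≥0)}

theorem abs_welfare_integrand_le (p : ℝ≥0) (x : ℝ≥0 × ℝ≥0) :
    |(x.1 : ℝ) + if x.1 ≤ p ∧ p ≤ x.2 then (x.2 : ℝ) - (x.1 : ℝ) else 0| ≤
      max (x.1 : ℝ) x.2 := by
  rw [← tradeValue_indicator]
  apply abs_tradeValue_le <;> split_ifs <;> norm_num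

theorem integrable_welfare_integrand (hμ : Integrable (fun x => max (x.1 : ℝ) x.2) μ) (p : ℝ≥0) :
    Integrable (fun x : ℝ≥0 × ℝ≥0 =>
      (x.1 : ℝ) + if x.1 ≤ p ∧ p ≤ x.2 then (x.2 : ℝ) - (x.1 : ℝ) else 0) μ :=
  hμ.mono' (measurable_welfare_integrand.comp measurable_prodMk_left).aestronglyMeasurable
    (.of_forall fun x => abs_welfare_integrand_le p x)

theorem integrable_tradeValue_bump (hμ : Integrable (fun x => max (x.1 : ℝ) x.2) μ) (k : ℕ)
    (t : ℝ) : Integrable (fun x => tradeValue (bump k t x) x) μ :=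
  hμ.mono' ((continuous_tradeValue_bump k).comp (Continuous.prodMk_right t)).aestronglyMeasurable
    (.of_forall fun x => abs_tradeValue_le (bump_nonneg k t x) (bump_le_one k t x) x)

theorem jointWelfare_nonneg (p : ℝ≥0) : 0 ≤ jointWelfare μ p := by
  refine integral_nonneg fun x => ?_
  simp only [Pi.zero_apply]
  split_ifs with h
  · have : (0 : ℝ) ≤ x.2 := x.2.2
    linarith
  · simp

theorem jointWelfare_le_jointOpt (hμ : Integrable (fun x => max (x.1 : ℝ) x.2) μ) (p : ℝ≥0) :
    jointWelfare μ p ≤ jointOpt μ :=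
  integral_mono (integrable_welfare_integrand hμ p) hμ
    fun x => (le_abs_self _).trans (abs_welfare_integrand_le p x)

theorem integrable_jointWelfare [SFinite μ] (hμ : Integrable (fun x => max (x.1 : ℝ) x.2) μ)
    (m : Measure ℝ≥0) [IsFiniteMeasure m] : Integrable (jointWelfare μ) m := by
  refine Integrable.of_bound (C := jointOpt μ) ?_ (.of_forall fun p => ?_)
  · exact (measurable_welfare_integrand.stronglyMeasurable.integral_prod_right'
      (ν := μ)).aestronglyMeasurable
  · rw [Real.norm_of_nonneg (jointWelfare_nonneg p)]
    exact jointWelfare_le_jointOpt hμ p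

theorem continuous_relaxedWelfare (hμ : Integrable (fun x => max (x.1 : ℝ) x.2) μ) (k : ℕ) :
    Continuous (relaxedWelfare μ k) := by
  refine continuous_of_dominated (bound := fun x => max (x.1 : ℝ) x.2)
    (fun t => (integrable_tradeValue_bump hμ k t).aestronglyMeasurable)
    (fun t => .of_forall fun x => abs_tradeValue_le (bump_nonneg k t x) (bump_le_one k t x) x)
    hμ (.of_forall fun x => ?_)
  exact (continuous_tradeValue_bump k).comp (Continuous.prodMk_left x)

theorem abs_relaxedWelfare_le (hμ : Integrable (fun x => max (x.1 : ℝ) x.2) μ) (k : ℕ) (t : ℝ) :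
    |relaxedWelfare μ k t| ≤ jointOpt μ := by
  rw [← Real.norm_eq_abs]
  exact norm_integral_le_of_norm_le hμ
    (.of_forall fun x => abs_tradeValue_le (bump_nonneg k t x) (bump_le_one k t x) x)

theorem relaxedWelfare_antitone (hμ : Integrable (fun x => max (x.1 : ℝ) x.2) μ) {k l : ℕ}
    (h : k ≤ l) (t : ℝ) : relaxedWelfare μ l t ≤ relaxedWelfare μ k t :=
  integral_mono (integrable_tradeValue_bump hμ l t) (integrable_tradeValue_bump hμ k t)
    fun x => tradeValue_mono (bump_antitone h t x) x

theorem jointWelfare_le_relaxedWelfare (hμ : Integrable (fun x => max (x.1 : ℝ) x.2) μ) (k : ℕ)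
    (p : ℝ≥0) : jointWelfare μ p ≤ relaxedWelfare μ k (squeeze p) := by
  refine integral_mono (integrable_welfare_integrand hμ p) (integrable_tradeValue_bump hμ k _)
    fun x => ?_
  dsimp only
  rw [← tradeValue_indicator]
  refine tradeValue_mono ?_ x
  split_ifs with h
  · rw [bump_eq_one (gap_eq_zero_iff.2 ⟨squeeze_mono h.1, squeeze_mono h.2⟩)]
  · exact bump_nonneg _ _ _

/-- The welfare under the sharp trade indicator, as a function of the squeezed price. -/
def squeezedWelfare (μ : Measure (ℝ≥0 × ℝ≥0)) (t : ℝ) : ℝ :=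
  ∫ x, tradeValue (if gap t x = 0 then 1 else 0) x ∂μ

theorem tendsto_relaxedWelfare (hμ : Integrable (fun x => max (x.1 : ℝ) x.2) μ) (t : ℝ) :
    Tendsto (fun k => relaxedWelfare μ k t) atTop (𝓝 (squeezedWelfare μ t)) := by
  refine tendsto_integral_of_dominated_convergence (fun x => max (x.1 : ℝ) x.2)
    (fun k => (integrable_tradeValue_bump hμ k t).aestronglyMeasurable) hμ
    (fun k => .of_forall fun x => abs_tradeValue_le (bump_nonneg k t x) (bump_le_one k t x) x)
    (.of_forall fun x => ?_)
  exact tendsto_const_nhds.add (tendsto_const_nhds.mul (tendsto_bump t x))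

theorem squeezedWelfare_le (hμ : Integrable (fun x => max (x.1 : ℝ) x.2) μ) (t : I) :
    squeezedWelfare μ t ≤ jointWelfare μ (unsqueeze t) := by
  refine integral_mono_of_nonneg (.of_forall fun x => ?_) (integrable_welfare_integrand hμ _)
    (.of_forall fun x => ?_)
  · have hm : (x.1 : ℝ) ≤ max (x.1 : ℝ) x.2 := le_max_left _ _
    have hs : (0 : ℝ) ≤ x.1 := x.1.2
    simp only [Pi.zero_apply, tradeValue]
    split_ifs <;> linarith
  · dsimp only
    rw [← tradeValue_indicator]
    refine tradeValue_mono ?_ x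
    by_cases h : gap t x = 0
    · obtain ⟨h1, h2⟩ := gap_eq_zero_iff.1 h
      rw [if_pos h, if_pos ⟨le_unsqueeze (h2.trans_lt (squeeze_lt_one _)) h1, unsqueeze_le h2⟩]
    · rw [if_neg h]
      split_ifs <;> norm_num

theorem integral_relaxedWelfare_limit [SFinite μ]
    (hμ : Integrable (fun x => max (x.1 : ℝ) x.2) μ) (m : Measure I) [IsFiniteMeasure m] {c : ℝ}
    (h : ∀ k, c ≤ ∫ t, relaxedWelfare μ k (t : ℝ) ∂m) :
    c ≤ ∫ p, jointWelfare μ p ∂(m.map unsqueeze) := by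
  have hlim : Tendsto (fun k => ∫ t, relaxedWelfare μ k (t : ℝ) ∂m) atTop
      (𝓝 (∫ t, squeezedWelfare μ (t : ℝ) ∂m)) :=
    tendsto_integral_of_dominated_convergence (fun _ => jointOpt μ)
      (fun k => ((continuous_relaxedWelfare hμ k).comp
        continuous_subtype_val).aestronglyMeasurable)
      (integrable_const _) (fun k => .of_forall fun t => abs_relaxedWelfare_le hμ k t)
      (.of_forall fun t => tendsto_relaxedWelfare hμ t)
  have hJ := integrable_jointWelfare hμ (m.map unsqueeze)
  rw [integral_map measurable_unsqueeze.aemeasurable hJ.aestronglyMeasurable]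
  refine (ge_of_tendsto' hlim h).trans ?_
  refine integral_mono_of_nonneg (.of_forall fun t => ?_)
    (hJ.comp_measurable measurable_unsqueeze) (.of_forall fun t => squeezedWelfare_le hμ t)
  refine ge_of_tendsto' (tendsto_relaxedWelfare hμ t) fun k => integral_nonneg fun x => ?_
  have hm : (x.1 : ℝ) ≤ max (x.1 : ℝ) x.2 := le_max_left _ _
  exact add_nonneg x.1.2 (mul_nonneg (by linarith) (bump_nonneg _ _ _))

variable {ν : Measure (ℝ≥0 × ℝ≥0)}

theorem integral_add_smul_nnreal {f : ℝ≥0 × ℝ≥0 → ℝ} (hμ : Integrable f μ) (hν : Integrable f ν)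
    (a b : ℝ≥0) :
    ∫ x, f x ∂(a • μ + b • ν) = (a : ℝ) * ∫ x, f x ∂μ + (b : ℝ) * ∫ x, f x ∂ν := by
  rw [integral_add_measure hμ.smul_measure_nnreal hν.smul_measure_nnreal,
    integral_smul_nnreal_measure, integral_smul_nnreal_measure]
  rfl

theorem jointOpt_add_smul (hμ : Integrable (fun x => max (x.1 : ℝ) x.2) μ)
    (hν : Integrable (fun x => max (x.1 : ℝ) x.2) ν) (a b : ℝ≥0) :
    jointOpt (a • μ + b • ν) = (a : ℝ) * jointOpt μ + (b : ℝ) * jointOpt ν :=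
  integral_add_smul_nnreal hμ hν a b

theorem relaxedWelfare_add_smul (hμ : Integrable (fun x => max (x.1 : ℝ) x.2) μ)
    (hν : Integrable (fun x => max (x.1 : ℝ) x.2) ν) (a b : ℝ≥0) (k : ℕ) (t : ℝ) :
    relaxedWelfare (a • μ + b • ν) k t =
      (a : ℝ) * relaxedWelfare μ k t + (b : ℝ) * relaxedWelfare ν k t :=
  integral_add_smul_nnreal (integrable_tradeValue_bump hμ k t)
    (integrable_tradeValue_bump hν k t) a b

end JointLaw

/-- If the joint laws in a convex family each admit prices that nearly guarantee the fraction `r`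
of the optimal welfare, then a single random price guarantees it for all of them. -/
theorem exists_price_distribution {Q : Set (Measure (ℝ≥0 × ℝ≥0))} (hne : Q.Nonempty)
    (hfin : ∀ μ ∈ Q, IsFiniteMeasure μ)
    (hint : ∀ μ ∈ Q, Integrable (fun x => max (x.1 : ℝ) x.2) μ)
    (hconv : ∀ μ ∈ Q, ∀ ν ∈ Q, ∀ a b : ℝ≥0, a + b = 1 → a • μ + b • ν ∈ Q) {r : ℝ}
    (h : ∀ μ ∈ Q, ∀ ε > 0, ∃ p, r * jointOpt μ - ε ≤ jointWelfare μ p) :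
    ∃ m : ProbabilityMeasure ℝ≥0, ∀ μ ∈ Q,
      r * jointOpt μ ≤ ∫ p, jointWelfare μ p ∂(m : Measure ℝ≥0) := by
  let A : Set C(I, ℝ) := {f | ∃ μ ∈ Q, ∃ k, ∀ t : I, relaxedWelfare μ k t - r * jointOpt μ ≤ f t}
  have hAmem : ∀ μ ∈ Q, ∀ k, ∃ f ∈ A, ∀ t : I, f t = relaxedWelfare μ k t - r * jointOpt μ :=
    fun μ hμ k => ⟨⟨fun t : I => relaxedWelfare μ k t - r * jointOpt μ,
      ((continuous_relaxedWelfare (hint μ hμ) k).comp continuous_subtype_val).sub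
        continuous_const⟩, ⟨μ, hμ, k, fun t => le_rfl⟩, fun t => rfl⟩
  have hAconv : Convex ℝ A := by
    rintro f ⟨μ, hμ, k, hf⟩ g ⟨ν, hν, l, hg⟩ a b ha hb hab
    lift a to ℝ≥0 using ha
    lift b to ℝ≥0 using hb
    refine ⟨_, hconv μ hμ ν hν a b (by exact_mod_cast hab), max k l, fun t => ?_⟩
    have h1 := (sub_le_sub_right
      (relaxedWelfare_antitone (hint μ hμ) (le_max_left k l) t) _).trans (hf t)
    have h2 := (sub_le_sub_right
      (relaxedWelfare_antitone (hint ν hν) (le_max_right k l) t) _).trans (hg t)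
    have h3 := mul_le_mul_of_nonneg_left h1 a.coe_nonneg
    have h4 := mul_le_mul_of_nonneg_left h2 b.coe_nonneg
    rw [jointOpt_add_smul (hint μ hμ) (hint ν hν),
      relaxedWelfare_add_smul (hint μ hμ) (hint ν hν)]
    simp only [ContinuousMap.add_apply, ContinuousMap.smul_apply, smul_eq_mul]
    linarith
  have hApos : ∀ f ∈ A, ∃ t, 0 ≤ f t := by
    rintro f ⟨μ, hμ, k, hf⟩
    obtain ⟨t, -, ht⟩ := isCompact_univ.exists_isMaxOn Set.univ_nonempty f.continuous.continuousOn
    refine ⟨t, le_of_forall_pos_le_add fun ε hε => ?_⟩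
    obtain ⟨p, hp⟩ := h μ hμ ε hε
    have h1 := hf ⟨squeeze p, squeeze_nonneg p, (squeeze_lt_one p).le⟩
    have h2 : f ⟨squeeze p, squeeze_nonneg p, (squeeze_lt_one p).le⟩ ≤ f t := ht (Set.mem_univ _)
    have h3 := jointWelfare_le_relaxedWelfare (hint μ hμ) k p
    simp only at h1
    linarith
  obtain ⟨μ₀, hμ₀⟩ := hne
  obtain ⟨f₀, hf₀, -⟩ := hAmem μ₀ hμ₀ 0
  obtain ⟨m, hm⟩ := exists_probabilityMeasure_integral_nonneg hAconv ⟨f₀, hf₀⟩ hApos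
  refine ⟨m.map measurable_unsqueeze.aemeasurable, fun μ hμ => ?_⟩
  have := hfin μ hμ
  refine integral_relaxedWelfare_limit (hint μ hμ) (m : Measure I) fun k => ?_
  obtain ⟨f, hf, hft⟩ := hAmem μ hμ k
  have h1 := hm f hf
  simp only [hft] at h1
  have hI : Integrable (fun t : I => relaxedWelfare μ k t) (m : Measure I) := by
    refine Integrable.of_bound (C := jointOpt μ) ?_
      (.of_forall fun t => abs_relaxedWelfare_le (hint μ hμ) k t)
    exact ((continuous_relaxedWelfare (hint μ hμ) k).comp
      continuous_subtype_val).aestronglyMeasurable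
  rw [integral_sub hI (integrable_const _), integral_const, probReal_univ, one_smul] at h1
  linarith

namespace ValueDist

attribute [instance] ValueDist.isProb

/-- The mixture of two value distributions. -/
def mix (F G : ValueDist) (a b : ℝ≥0) (hab : a + b = 1) : ValueDist where
  law := a • F.law + b • G.law
  isProb := ⟨by
    simp only [Measure.add_apply, Measure.smul_apply, measure_univ]
    rw [ENNReal.smul_def, ENNReal.smul_def, smul_eq_mul, smul_eq_mul, mul_one, mul_one]
    exact_mod_cast hab⟩
  finiteMean := F.finiteMean.smul_measure_nnreal.add_measure G.finiteMean.smul_measure_nnreal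

/-- The uniform distribution on `[0, 1]`. -/
def uniform : ValueDist where
  law := (volume.restrict (Set.Icc (0 : ℝ) 1)).map Real.toNNReal
  isProb :=
    have : IsProbabilityMeasure (volume.restrict (Set.Icc (0 : ℝ) 1)) := ⟨by simp⟩
    Measure.isProbabilityMeasure_map measurable_real_toNNReal.aemeasurable
  finiteMean := by
    rw [integrable_map_measure (by fun_prop) measurable_real_toNNReal.aemeasurable]
    refine Integrable.of_bound (C := 1) (by fun_prop) ?_
    filter_upwards [ae_restrict_mem measurableSet_Icc] with x hx
    rw [Function.comp_apply, Real.norm_of_nonneg (NNReal.coe_nonneg _), Real.coe_toNNReal _ hx.1]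
    exact hx.2

theorem uniform_mem_continuousDists : uniform ∈ continuousDists := by
  intro x
  change ((volume.restrict (Set.Icc (0 : ℝ) 1)).map Real.toNNReal) {x} = 0
  rw [Measure.map_apply measurable_real_toNNReal (measurableSet_singleton x),
    Measure.restrict_apply (measurable_real_toNNReal (measurableSet_singleton x))]
  refine measure_mono_null (t := {(x : ℝ)}) ?_ (measure_singleton _)
  rintro y ⟨hy, hy0⟩
  rw [Set.mem_preimage, Set.mem_singleton_iff] at hy
  rw [Set.mem_singleton_iff, ← hy, Real.coe_toNNReal _ hy0.1]

theorem mix_mem_continuousDists {F G : ValueDist} (hF : F ∈ continuousDists)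
    (hG : G ∈ continuousDists) (a b : ℝ≥0) (hab : a + b = 1) :
    F.mix G a b hab ∈ continuousDists := by
  intro x
  simp [mix, hF x, hG x]

end ValueDist

theorem integrable_max (FS FB : ValueDist) :
    Integrable (fun x : ℝ≥0 × ℝ≥0 => max (x.1 : ℝ) x.2) (FS.law.prod FB.law) :=
  (FS.finiteMean.comp_fst FB.law).sup (FB.finiteMean.comp_snd FS.law)

theorem optWelfare_nonneg (FS FB : ValueDist) : 0 ≤ optWelfare FS FB :=
  integral_nonneg fun x => le_max_of_le_left x.1.2

theorem optWelfare_pos_of_mem_continuousDists {F : ValueDist} (hF : F ∈ continuousDists)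
    (G : ValueDist) : 0 < optWelfare F G := by
  refine (optWelfare_nonneg F G).lt_of_ne' fun h0 => ?_
  unfold optWelfare at h0
  rw [integral_eq_zero_iff_of_nonneg (fun x => le_max_of_le_left x.1.2) (integrable_max F G)] at h0
  have h1 : ∀ᵐ x ∂(F.law.prod G.law), x.1 = 0 := by
    filter_upwards [h0] with x hx
    have hle : (x.1 : ℝ) ≤ max (x.1 : ℝ) x.2 := le_max_left _ _
    have hx' : max (x.1 : ℝ) x.2 = 0 := hx
    exact_mod_cast le_antisymm (hle.trans hx'.le) x.1.2
  have h2 : ∀ᵐ x ∂(F.law.prod G.law), x.1 ≠ 0 :=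
    Measure.quasiMeasurePreserving_fst.ae (p := fun s => s ≠ 0) (by
      rw [ae_iff]
      simpa using hF 0)
  obtain ⟨x, hx, hx'⟩ := (h1.and h2).exists
  exact hx' hx

theorem welfare_nonneg (M : Mechanism) (FS FB : ValueDist) : 0 ≤ welfare M FS FB :=
  integral_nonneg fun p => jointWelfare_nonneg p

theorem exists_welfare_le_priceWelfare (M : Mechanism) (FS FB : ValueDist) :
    ∃ p, welfare M FS FB ≤ priceWelfare p FS FB :=
  exists_integral_le (integrable_jointWelfare (integrable_max FS FB) _)

theorem welfare_le_optWelfare (M : Mechanism) (FS FB : ValueDist) :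
    welfare M FS FB ≤ optWelfare FS FB := by
  obtain ⟨p, hp⟩ := exists_welfare_le_priceWelfare M FS FB
  exact hp.trans (jointWelfare_le_jointOpt (integrable_max FS FB) p)

section Class

variable {D : Set ValueDist}

theorem approxRatio_mul_optWelfare_le {FS FB : ValueDist} (hS : FS ∈ D) (hB : FB ∈ D)
    (M : Mechanism) : approxRatio D M * optWelfare FS FB ≤ welfare M FS FB := by
  rcases (optWelfare_nonneg FS FB).eq_or_lt with h0 | hpos
  · rw [← h0, mul_zero]
    exact welfare_nonneg M FS FB
  · rw [← le_div_iff₀ hpos]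
    refine csInf_le ⟨0, ?_⟩ ⟨FS, hS, FB, hB, hpos, rfl⟩
    rintro _ ⟨FS, -, FB, -, -, rfl⟩
    exact div_nonneg (welfare_nonneg M FS FB) (optWelfare_nonneg FS FB)

theorem le_approxRatio (hD : ∃ FS ∈ D, ∃ FB ∈ D, 0 < optWelfare FS FB) {M : Mechanism} {r : ℝ}
    (h : ∀ FS ∈ D, ∀ FB ∈ D, r * optWelfare FS FB ≤ welfare M FS FB) : r ≤ approxRatio D M := by
  refine le_csInf ?_ ?_
  · obtain ⟨FS, hS, FB, hB, hpos⟩ := hD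
    exact ⟨_, FS, hS, FB, hB, hpos, rfl⟩
  · rintro _ ⟨FS, hS, FB, hB, hpos, rfl⟩
    rw [le_div_iff₀ hpos]
    exact h FS hS FB hB

theorem approxRatio_le_one (hD : ∃ FS ∈ D, ∃ FB ∈ D, 0 < optWelfare FS FB) (M : Mechanism) :
    approxRatio D M ≤ 1 := by
  obtain ⟨FS, hS, FB, hB, hpos⟩ := hD
  have := (approxRatio_mul_optWelfare_le hS hB M).trans (welfare_le_optWelfare M FS FB)
  exact le_of_mul_le_mul_right (this.trans_eq (one_mul _).symm) hpos

variable {r : ℝ}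

theorem exists_buyerOnly (hne : D.Nonempty)
    (hmix : ∀ F ∈ D, ∀ G ∈ D, ∀ a b hab, F.mix G a b hab ∈ D)
    (h : ∀ FS ∈ D, ∀ FB ∈ D, ∀ ε > 0, ∃ p, r * optWelfare FS FB - ε ≤ priceWelfare p FS FB) :
    ∃ M : Mechanism, M.BuyerOnly ∧
      ∀ FS ∈ D, ∀ FB ∈ D, r * optWelfare FS FB ≤ welfare M FS FB := by
  have key : ∀ FB : ValueDist, ∃ m : ProbabilityMeasure ℝ≥0, FB ∈ D → ∀ FS ∈ D,
      r * optWelfare FS FB ≤ ∫ p, priceWelfare p FS FB ∂(m : Measure ℝ≥0) := by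
    intro FB
    by_cases hB : FB ∈ D
    · obtain ⟨m, hm⟩ := exists_price_distribution (r := r)
        (Q := (fun FS : ValueDist => FS.law.prod FB.law) '' D) (hne.image _)
        (by
          rintro _ ⟨FS, -, rfl⟩
          dsimp only
          infer_instance)
        (by
          rintro _ ⟨FS, -, rfl⟩
          exact integrable_max FS FB)
        (by
          rintro _ ⟨F, hF, rfl⟩ _ ⟨G, hG, rfl⟩ a b hab
          refine ⟨F.mix G a b hab, hmix F hF G hG a b hab, ?_⟩
          simp only [ValueDist.mix]
          rw [Measure.add_prod, Measure.prod_smul_left, Measure.prod_smul_left])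
        (by
          rintro _ ⟨FS, hS, rfl⟩
          exact h FS hS FB hB)
      exact ⟨m, fun _ FS hS => hm _ ⟨FS, hS, rfl⟩⟩
    · exact ⟨⟨Measure.dirac 0, inferInstance⟩, fun hB' => absurd hB' hB⟩
  choose m hm using key
  exact ⟨fun _ FB => m FB, ⟨m, fun _ _ => rfl⟩, fun FS hS FB hB => hm FB hB FS hS⟩

theorem exists_sellerOnly (hne : D.Nonempty)
    (hmix : ∀ F ∈ D, ∀ G ∈ D, ∀ a b hab, F.mix G a b hab ∈ D)
    (h : ∀ FS ∈ D, ∀ FB ∈ D, ∀ ε > 0, ∃ p, r * optWelfare FS FB - ε ≤ priceWelfare p FS FB) :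
    ∃ M : Mechanism, M.SellerOnly ∧
      ∀ FS ∈ D, ∀ FB ∈ D, r * optWelfare FS FB ≤ welfare M FS FB := by
  have key : ∀ FS : ValueDist, ∃ m : ProbabilityMeasure ℝ≥0, FS ∈ D → ∀ FB ∈ D,
      r * optWelfare FS FB ≤ ∫ p, priceWelfare p FS FB ∂(m : Measure ℝ≥0) := by
    intro FS
    by_cases hS : FS ∈ D
    · obtain ⟨m, hm⟩ := exists_price_distribution (r := r)
        (Q := (fun FB : ValueDist => FS.law.prod FB.law) '' D) (hne.image _)
        (by
          rintro _ ⟨FB, -, rfl⟩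
          dsimp only
          infer_instance)
        (by
          rintro _ ⟨FB, -, rfl⟩
          exact integrable_max FS FB)
        (by
          rintro _ ⟨F, hF, rfl⟩ _ ⟨G, hG, rfl⟩ a b hab
          refine ⟨F.mix G a b hab, hmix F hF G hG a b hab, ?_⟩
          simp only [ValueDist.mix]
          rw [Measure.prod_add, Measure.prod_smul_right, Measure.prod_smul_right])
        (by
          rintro _ ⟨FB, hB, rfl⟩
          exact h FS hS FB hB)
      exact ⟨m, fun _ FB hB => hm _ ⟨FB, hB, rfl⟩⟩
    · exact ⟨⟨Measure.dirac 0, inferInstance⟩, fun hS' => absurd hS' hS⟩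
  choose m hm using key
  exact ⟨fun FS _ => m FS, ⟨m, fun _ _ => rfl⟩, fun FS hS FB hB => hm FS hS FB hB⟩

theorem exists_optimalRatio (hD : ∃ FS ∈ D, ∃ FB ∈ D, 0 < optWelfare FS FB)
    (hmix : ∀ F ∈ D, ∀ G ∈ D, ∀ a b hab, F.mix G a b hab ∈ D) :
    ∃ r : ℝ, IsOptimalRatio D (fun _ => True) r ∧ IsOptimalRatio D Mechanism.BuyerOnly r ∧
      IsOptimalRatio D Mechanism.SellerOnly r := by
  have hbdd : BddAbove (Set.range (approxRatio D)) :=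
    ⟨1, by rintro _ ⟨M, rfl⟩; exact approxRatio_le_one hD M⟩
  have hle : ∀ M, approxRatio D M ≤ ⨆ M, approxRatio D M := fun M => le_ciSup hbdd M
  have : Nonempty Mechanism := ⟨fun _ _ => ⟨Measure.dirac 0, inferInstance⟩⟩
  have h : ∀ FS ∈ D, ∀ FB ∈ D, ∀ ε > 0,
      ∃ p, (⨆ M, approxRatio D M) * optWelfare FS FB - ε ≤ priceWelfare p FS FB := by
    intro FS hS FB hB ε hε
    have hopt := optWelfare_nonneg FS FB
    obtain ⟨M, hM⟩ := exists_lt_of_lt_ciSup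
      (sub_lt_self (⨆ M, approxRatio D M) (div_pos hε (by linarith : 0 < optWelfare FS FB + 1)))
    obtain ⟨p, hp⟩ := exists_welfare_le_priceWelfare M FS FB
    refine ⟨p, le_trans ?_ ((approxRatio_mul_optWelfare_le hS hB M).trans hp)⟩
    have h1 := mul_le_mul_of_nonneg_right hM.le hopt
    have h2 : ε / (optWelfare FS FB + 1) * optWelfare FS FB ≤ ε := by
      rw [div_mul_eq_mul_div, div_le_iff₀ (by linarith)]
      nlinarith
    linarith
  have hne : D.Nonempty := hD.imp fun _ => And.left
  have hopt : ∀ {P : Mechanism → Prop}, (∃ M, P M ∧ ∀ FS ∈ D, ∀ FB ∈ D,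
      (⨆ M, approxRatio D M) * optWelfare FS FB ≤ welfare M FS FB) →
      IsOptimalRatio D P (⨆ M, approxRatio D M) := by
    rintro P ⟨M, hP, hM⟩
    refine ⟨⟨M, hP, le_antisymm (le_approxRatio hD hM) (hle M)⟩, ?_⟩
    rintro _ ⟨M', -, rfl⟩
    exact hle M'
  have hB := exists_buyerOnly hne hmix h
  exact ⟨_, hopt (hB.imp fun M hM => ⟨trivial, hM.2⟩), hopt hB,
    hopt (exists_sellerOnly hne hmix h)⟩

end Class

end BilateralTrade

end

theorem theorem2 (D : Set BilateralTrade.ValueDist)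
    (hD : D = BilateralTrade.continuousDists ∨ D = BilateralTrade.allDists) :
    ∃ r : ℝ,
      BilateralTrade.IsOptimalRatio D (fun _ => True) r ∧
      BilateralTrade.IsOptimalRatio D BilateralTrade.Mechanism.BuyerOnly r ∧
      BilateralTrade.IsOptimalRatio D BilateralTrade.Mechanism.SellerOnly r := by
  have hu := BilateralTrade.ValueDist.uniform_mem_continuousDists
  have hpos := BilateralTrade.optWelfare_pos_of_mem_continuousDists hu
    BilateralTrade.ValueDist.uniform
  rcases hD with rfl | rfl
  · exact BilateralTrade.exists_optimalRatio ⟨_, hu, _, hu, hpos⟩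
      fun F hF G hG a b hab => BilateralTrade.ValueDist.mix_mem_continuousDists hF hG a b hab
  · exact BilateralTrade.exists_optimalRatio ⟨_, Set.mem_univ _, _, Set.mem_univ _, hpos⟩
      fun F _ G _ a b hab => Set.mem_univ _
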